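/- For $n\ge 1$ let $$c_n=\frac1n\sum_{d\mid n,\ d\ \mathrm{odd}}\mu(d)\,2^{n/d-1},$$ where $\mu$ is the Möbius function. A permutation $\sigma\in S_n$ is called unimodal if for some $k\in\{1,\ldots,n\}$ one has $\sigma(1)<\cdots<\sigma(k)>\sigma(k+1)>\cdots>\sigma(n)$. For $m\ge 1$ let $v_n^{(m)}$ be the number of unimodal permutations $\sigma\in S_n$ with $\sigma^m=1$. Then every $c_n$ is a nonnegative integer and, for every $m\ge 1$, the generating function $\sum_{n\ge1}v_n^{(m)}t^n$ is a rational function, with $$1+2\sum_{n\ge 1}v_n^{(m)}t^n=\prod_{d\mid m}\left(\frac{1+t^d}{1-t^d}\right)^{c_d}$$ as formal power series with rational coefficients. -/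

import Mathlib

/-- A permutation `σ` of `{0, …, n-1}` is unimodal if for some position `k` its values
`σ 0 < ⋯ < σ k` increase up to `k` and `σ k > ⋯ > σ (n-1)` decrease from `k` on. -/
def IsUnimodal {n : ℕ} (σ : Equiv.Perm (Fin n)) : Prop :=
  ∃ k : Fin n, StrictMonoOn σ (Set.Iic k) ∧ StrictAntiOn σ (Set.Ici k)

/-- The number `v_n^{(m)}` of unimodal permutations `σ ∈ S_n` with `σ ^ m = 1`. -/
noncomputable def unimodalRootCount (m n : ℕ) : ℕ :=
  Nat.card {σ : Equiv.Perm (Fin n) // IsUnimodal σ ∧ σ ^ m = 1}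

/-- The rational number `c_n = (1 / n) ∑_{d ∣ n, d odd} μ(d) 2 ^ (n / d - 1)`, for `n ≥ 1`. -/
def unimodalC (n : ℕ) : ℚ :=
  (1 / (n : ℚ)) * ∑ d ∈ n.divisors with Odd d,
    (ArithmeticFunction.moebius d : ℚ) * 2 ^ (n / d - 1)

/-- The generating function `∑_{n ≥ 1} v_n^{(m)} t ^ n`. -/
noncomputable def unimodalRootSeries (m : ℕ) : PowerSeries ℚ :=
  PowerSeries.mk fun n => if n = 0 then 0 else (unimodalRootCount m n : ℚ)

/-- A formal power series is (the expansion of) a rational function if it is a quotient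
of two polynomials. -/
def IsRationalSeries (F : PowerSeries ℚ) : Prop :=
  ∃ P Q : Polynomial ℚ, Q ≠ 0 ∧ (Q : PowerSeries ℚ) * F = (P : PowerSeries ℚ)

/-! Call `(σ, ε)` signed when `ε` is monotone and `σ` increases where `ε` is false and decreases
where it is true. On a nonempty set a unimodal permutation carries exactly two signs, differing only
at the peak; this is the factor 2 (`card_signedRoot_succ`). Code each point by the prefix parities
of the signs along its orbit. Then `σ` acts as the tent map and the order of points is compatible
with the lexicographic order of codes, so when `σ ^ m = 1` the pair is determined by its multiset of
codes, all of period `m`. The multiplicities that occur are those invariant under the tent map and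
at most 1 on codes whose letter `m - 1` is true, since `σ ^ m` would reverse equal copies of such a
code (`card_signedRoot`). Hence the series is a product over tent orbits: `1 + t^d` for an odd orbit
of size `d`, `1 / (1 - t^d)` for an even one (`one_add_two_mul_series_eq_prod_orbits`).

Each parity occurs for half of the `2^m` points of period `m`. A point of minimal period `d` keeps
its parity over `m` if `m / d` is odd and becomes even otherwise. Möbius inversion over odd divisors
identifies `c_d` with the number of odd orbits of size `d` (`tentCount_true_eq_sum`). Comparing the
two parities gives `c_d - c_{d/2}` even orbits, the last term being absent for odd `d`
(`tentCount_true_div`). Finally `1 / (1 - t^d) = (1 + t^d) / (1 - t^(2d))` regroups the orbit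
product into the stated one (`one_add_two_mul_series_eq`). -/

/-! ### Periodic points of the tent map -/

/-- The tent map on binary sequences: the shift, followed by complementation when the deleted
letter is `true`. -/
def tent (y : ℕ → Bool) : ℕ → Bool := fun j => xor (y (j + 1)) (y 0)

theorem tent_iterate_succ (y : ℕ → Bool) (l j : ℕ) :
    tent^[l + 1] y j = xor (y (j + l + 1)) (y l) := by
  induction l generalizing j with
  | zero => rfl
  | succ l ih =>
    rw [Function.iterate_succ_apply']
    simp only [tent, ih]
    rw [show j + 1 + l + 1 = j + (l + 1) + 1 by ring, show 0 + l + 1 = l + 1 by ring]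
    cases y (j + (l + 1) + 1) <;> cases y (l + 1) <;> cases y l <;> rfl

/-- The points of period `m` of the tent map. -/
abbrev TentPt (m : ℕ) : Type := {y : ℕ → Bool // tent^[m] y = y}

/-- The letter `y k` is the parity of the block: it decides between periodicity and antiperiodicity
under a shift by `k + 1`. -/
theorem tent_iterate_eq_self_iff (k : ℕ) (y : ℕ → Bool) :
    tent^[k + 1] y = y ↔ ∀ j, y (j + (k + 1)) = xor (y j) (y k) := by
  rw [funext_iff]
  refine forall_congr' fun j => ?_
  rw [tent_iterate_succ, ← add_assoc]
  cases y (j + k + 1) <;> cases y j <;> cases y k <;> decide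

/-- The antiperiodic or periodic extension of a finite word. -/
def tentExtend {k : ℕ} (w : Fin (k + 1) → Bool) : ℕ → Bool := fun j =>
  xor (w (Fin.ofNat (k + 1) j)) (decide (j / (k + 1) % 2 = 1) && w (Fin.last k))

theorem tentExtend_apply_of_lt {k : ℕ} (w : Fin (k + 1) → Bool) (i : Fin (k + 1)) :
    tentExtend w i = w i := by
  simp [tentExtend, Nat.div_eq_of_lt i.2]

theorem tent_iterate_tentExtend {k : ℕ} (w : Fin (k + 1) → Bool) :
    tent^[k + 1] (tentExtend w) = tentExtend w := by
  rw [tent_iterate_eq_self_iff]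
  intro j
  have h := tentExtend_apply_of_lt w (Fin.last k)
  rw [Fin.val_last] at h
  rw [h]
  have h1 : Fin.ofNat (k + 1) (j + (k + 1)) = Fin.ofNat (k + 1) j := by
    ext; simp
  have h2 : (j + (k + 1)) / (k + 1) = j / (k + 1) + 1 := Nat.add_div_right _ (Nat.succ_pos k)
  simp only [tentExtend, h1, h2]
  rcases Nat.mod_two_eq_zero_or_one (j / (k + 1)) with h3 | h3
  · have : (j / (k + 1) + 1) % 2 = 1 := by omega
    simp [h3, this]
  · have : (j / (k + 1) + 1) % 2 = 0 := by omega
    simp [h3, this]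

theorem tent_periodic_ext {k : ℕ} {y z : ℕ → Bool} (hy : tent^[k + 1] y = y)
    (hz : tent^[k + 1] z = z) (h : ∀ i : Fin (k + 1), y i = z i) : y = z := by
  rw [tent_iterate_eq_self_iff] at hy hz
  funext j
  induction j using Nat.strong_induction_on with
  | _ j ih =>
    by_cases hj : j < k + 1
    · exact h ⟨j, hj⟩
    · obtain ⟨i, rfl⟩ := Nat.exists_eq_add_of_le' (not_lt.1 hj)
      rw [hy, hz, ih i (by omega), ih k (by omega)]

/-- A point of period `k + 1` is determined by its first `k + 1` letters, which are arbitrary. -/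
def tentPtEquiv (k : ℕ) : TentPt (k + 1) ≃ (Fin (k + 1) → Bool) where
  toFun y i := y.1 i
  invFun w := ⟨tentExtend w, tent_iterate_tentExtend w⟩
  left_inv y := Subtype.ext <| tent_periodic_ext (tent_iterate_tentExtend fun i => y.1 i) y.2 fun i =>
    tentExtend_apply_of_lt (fun i => y.1 i) i
  right_inv w := funext fun i => tentExtend_apply_of_lt w i

theorem card_word_last_eq (k : ℕ) (b : Bool) :
    Nat.card {w : Fin (k + 1) → Bool // w (Fin.last k) = b} = 2 ^ k := by
  have e : {w : Fin (k + 1) → Bool // w (Fin.last k) = b} ≃ (Fin k → Bool) :=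
    { toFun := fun w => Fin.init w.1
      invFun := fun v => ⟨Fin.snoc (α := fun _ => Bool) v b, by simp⟩
      left_inv := fun w => Subtype.ext <| by
        obtain ⟨w, rfl⟩ := w
        simp
      right_inv := fun v => by simp }
  rw [Nat.card_congr e]
  simp

theorem card_tentPt_last_eq (k : ℕ) (b : Bool) :
    Nat.card {y : TentPt (k + 1) // y.1 k = b} = 2 ^ k := by
  rw [← card_word_last_eq k b]
  exact Nat.card_congr ((tentPtEquiv k).subtypeEquiv fun y => Iff.rfl)

theorem finite_tentPt {m : ℕ} (hm : 0 < m) : Finite (TentPt m) := by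
  obtain ⟨k, rfl⟩ := Nat.exists_eq_add_of_lt hm
  rw [zero_add]
  exact Finite.of_equiv _ (tentPtEquiv k).symm

/-- The last letter over a multiple of a period is the parity-weighted last letter. -/
theorem tent_last_mul {k : ℕ} {y : ℕ → Bool} (hy : tent^[k + 1] y = y) (q : ℕ) :
    y ((q + 1) * (k + 1) - 1) = (decide (Odd (q + 1)) && y k) := by
  rw [tent_iterate_eq_self_iff] at hy
  induction q with
  | zero => simp
  | succ q ih =>
    have : (q + 1 + 1) * (k + 1) - 1 = ((q + 1) * (k + 1) - 1) + (k + 1) := by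
      have : 0 < (q + 1) * (k + 1) := by positivity
      rw [add_mul (q + 1) 1]; omega
    rw [this, hy, ih]
    by_cases h : Odd (q + 1) <;> simp [h, Nat.odd_add_one (n := q + 1)]

/-- The restriction of the tent map to its points of period `m`. -/
def tentPerm {m : ℕ} (hm : 0 < m) : Equiv.Perm (TentPt m) where
  toFun y := ⟨tent y.1, by rw [← Function.iterate_succ_apply, Function.iterate_succ_apply', y.2]⟩
  invFun y := ⟨tent^[m - 1] y.1, by
    rw [← Function.iterate_add_apply, add_comm, Function.iterate_add_apply, y.2]⟩
  left_inv y := Subtype.ext <| by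
    change tent^[m - 1] (tent y.1) = y.1
    rw [← Function.iterate_succ_apply, Nat.sub_one, Nat.succ_pred hm.ne', y.2]
  right_inv y := Subtype.ext <| by
    change tent (tent^[m - 1] y.1) = y.1
    rw [← Function.iterate_succ_apply' tent, Nat.sub_one, Nat.succ_pred hm.ne', y.2]

theorem tentPerm_iterate_val {m : ℕ} (hm : 0 < m) (l : ℕ) (y : TentPt m) :
    ((tentPerm hm)^[l] y).1 = tent^[l] y.1 := by
  induction l with
  | zero => rfl
  | succ l ih => rw [Function.iterate_succ_apply', Function.iterate_succ_apply', ← ih]; rfl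

theorem minimalPeriod_tentPerm {m : ℕ} (hm : 0 < m) (y : TentPt m) :
    Function.minimalPeriod (tentPerm hm) y = Function.minimalPeriod tent y.1 := by
  refine Function.minimalPeriod_eq_minimalPeriod_iff.2 fun n => ?_
  rw [Function.IsPeriodicPt, Function.IsFixedPt, Function.IsPeriodicPt, Function.IsFixedPt,
    Subtype.ext_iff, tentPerm_iterate_val]

/-- The last letter over any period of a point is invariant under the tent map. -/
theorem tent_last_invariant {m : ℕ} (hm : 0 < m) {y : ℕ → Bool} (hy : tent^[m] y = y) :
    tent y (m - 1) = y (m - 1) := by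
  obtain ⟨k, rfl⟩ := Nat.exists_eq_add_of_lt hm
  rw [zero_add] at *
  rw [tent_iterate_eq_self_iff] at hy
  have := hy 0
  simp only [zero_add] at this
  simp only [tent, Nat.add_sub_cancel, this]
  cases y 0 <;> cases y k <;> rfl

/-! ### Signed permutations and itineraries -/

open Equiv Function

/-- `σ` is increasing on the initial segment `ε = false` and decreasing on the final segment
`ε = true`. -/
structure IsSigned {α : Type*} [LinearOrder α] (σ : Perm α) (ε : α → Bool) : Prop where
  mono : Monotone ε
  lt_of_false : ∀ ⦃i j⦄, i < j → ε j = false → σ i < σ j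
  lt_of_true : ∀ ⦃i j⦄, i < j → ε i = true → σ j < σ i

/-- The itinerary of a point under `σ`, recorded through the parities of its prefixes. -/
def itinerary {α : Type*} (σ : α → α) (ε : α → Bool) (i : α) : ℕ → Bool
  | 0 => ε i
  | j + 1 => xor (itinerary σ ε (σ i) j) (ε i)

theorem itinerary_apply {α : Type*} (σ : α → α) (ε : α → Bool) (i : α) :
    itinerary σ ε (σ i) = tent (itinerary σ ε i) := by
  funext j
  simp only [tent, itinerary]
  cases itinerary σ ε (σ i) j <;> cases ε i <;> rfl

theorem itinerary_iterate {α : Type*} (σ : α → α) (ε : α → Bool) (l : ℕ) (i : α) :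
    itinerary σ ε (σ^[l] i) = tent^[l] (itinerary σ ε i) := by
  induction l with
  | zero => rfl
  | succ l ih => rw [iterate_succ_apply', iterate_succ_apply', itinerary_apply, ih]

theorem eq_itinerary {α : Type*} {σ : α → α} {ε : α → Bool} {f : α → ℕ → Bool}
    (h : ∀ i, f (σ i) = tent (f i)) (h0 : ∀ i, f i 0 = ε i) : f = itinerary σ ε := by
  funext i j
  induction j generalizing i with
  | zero => exact h0 i
  | succ j ih =>
    rw [itinerary, ← ih, h, ← h0]
    simp only [tent]
    cases f i (j + 1) <;> cases f i 0 <;> rfl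

namespace IsSigned

variable {α : Type*} [LinearOrder α] {σ : Perm α} {ε : α → Bool}

/-- Agreement before `r` means equal signs so far, so the iterates keep or reverse the order of `i`
and `j` together. Recording parities instead of signs absorbs the reversals, which makes the plain
lexicographic order the right one. -/
theorem lt_of_itinerary (h : IsSigned σ ε) (r : ℕ) {i j : α}
    (hl : ∀ l < r, itinerary σ ε i l = itinerary σ ε j l)
    (hi : itinerary σ ε i r = false) (hj : itinerary σ ε j r = true) : i < j := by
  induction r generalizing i j with
  | zero =>
    by_contra hij
    have := h.mono (not_lt.1 hij)
    simp only [itinerary] at hi hj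
    rw [hi, hj] at this
    exact absurd this (by decide)
  | succ r ih =>
    have h0 : ε i = ε j := hl 0 (Nat.succ_pos r)
    have hl' : ∀ l < r, itinerary σ ε (σ i) l = itinerary σ ε (σ j) l := fun l hlr => by
      have := hl (l + 1) (Nat.succ_lt_succ hlr)
      simpa [itinerary, h0] using this
    simp only [itinerary, ← h0] at hi hj
    cases hb : ε i with
    | false =>
      simp only [hb, Bool.xor_false] at hi hj
      have hlt := ih hl' hi hj
      by_contra hij
      rcases (not_lt.1 hij).eq_or_lt with rfl | hji
      · exact lt_irrefl _ hlt
      · exact lt_asymm hlt (h.lt_of_false hji hb)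
    | true =>
      simp only [hb, Bool.xor_true, Bool.not_eq_false', Bool.not_eq_true'] at hi hj
      have hlt := ih (fun l hlr => (hl' l hlr).symm) hj hi
      by_contra hij
      rcases (not_lt.1 hij).eq_or_lt with rfl | hji
      · exact lt_irrefl _ hlt
      · exact lt_asymm hlt (h.lt_of_true hji (h0 ▸ hb))

theorem monotone_itinerary (h : IsSigned σ ε) :
    Monotone fun i => toLex (itinerary σ ε i) := by
  intro i j hij
  by_contra hlt
  obtain ⟨r, hr, hr'⟩ := not_le.1 hlt
  have h1 := Bool.lt_iff.1 hr'
  exact not_lt.2 hij (h.lt_of_itinerary r hr h1.1 h1.2)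

/-- Each true sign reverses the order once, and letter `l` is the parity of the reversals in the
first `l + 1` steps. -/
theorem iterate_lt (h : IsSigned σ ε) (l : ℕ) {i j : α} (hij : i < j)
    (he : itinerary σ ε i = itinerary σ ε j) :
    if itinerary σ ε i l then σ^[l + 1] j < σ^[l + 1] i else σ^[l + 1] i < σ^[l + 1] j := by
  induction l generalizing i j with
  | zero =>
    have h0 : ε i = ε j := congrFun he 0
    simp only [itinerary, zero_add, iterate_one]
    cases hb : ε i with
    | false => simpa using h.lt_of_false hij (h0 ▸ hb)
    | true => simpa using h.lt_of_true hij hb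
  | succ l ih =>
    have h0 : ε i = ε j := congrFun he 0
    have he' : itinerary σ ε (σ i) = itinerary σ ε (σ j) := by
      rw [itinerary_apply, itinerary_apply, he]
    rw [iterate_succ_apply σ (l + 1) i, iterate_succ_apply σ (l + 1) j]
    simp only [itinerary]
    rcases Bool.eq_false_or_eq_true (ε i) with hb | hb
    · have := ih (h.lt_of_true hij hb) he'.symm
      rw [← he'] at this
      rcases Bool.eq_false_or_eq_true (itinerary σ ε (σ i) l) with hc | hc <;>
        simpa [hb, hc] using this
    · simpa [hb] using ih (h.lt_of_false hij (h0 ▸ hb)) he'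

end IsSigned

/-- Monotone tuples with fibers of the same sizes are equal. -/
theorem eq_of_monotone_of_card_fiber_eq {n : ℕ} {β : Type*} [LinearOrder β] {f g : Fin n → β}
    (hf : Monotone f) (hg : Monotone g)
    (h : ∀ x, Nat.card {i // f i = x} = Nat.card {i // g i = x}) : f = g := by
  let e : Fin n ≃ Fin n :=
    Equiv.ofFiberEquiv (f := f) (g := g) fun x => (Finite.card_eq.1 (h x)).some
  have he : g ∘ e = f := funext fun i => Equiv.ofFiberEquiv_map _ i
  have := Tuple.unique_monotone (f := g) (σ := e) (τ := 1) (by rwa [he]) hg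
  rw [he] at this
  exact this

theorem perm_eq_one_of_strictMono {n : ℕ} {τ : Perm (Fin n)} (h : StrictMono τ) : τ = 1 := by
  have : (h.orderIsoOfSurjective τ τ.surjective) = OrderIso.refl (Fin n) := Subsingleton.elim _ _
  ext i
  exact congrArg Fin.val (DFunLike.congr_fun this i)

/-- A signed permutation of finite order is determined by its multiset of itineraries. -/
theorem IsSigned.eq_of_itinerary_eq {n m : ℕ} (hm : 0 < m) {σ σ' : Perm (Fin n)}
    {ε ε' : Fin n → Bool} (h : IsSigned σ ε) (h' : IsSigned σ' ε') (hσ : σ ^ m = 1)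
    (hf : itinerary σ ε = itinerary σ' ε') : σ = σ' ∧ ε = ε' := by
  have hε : ε = ε' := funext fun i => congrFun (congrFun hf i) 0
  refine ⟨?_, hε⟩
  subst hε
  set f := itinerary σ ε with hfdef
  -- The tent map is two-to-one in general, but injective on points of period `m`.
  have hinj : ∀ i j, tent (f i) = tent (f j) → f i = f j := by
    intro i j hij
    have hp : ∀ i, tent^[m] (f i) = f i := fun i => by
      rw [hfdef, ← itinerary_iterate, ← Perm.coe_pow, hσ, Perm.one_apply]
    rw [← hp i, ← hp j, ← Nat.succ_pred hm.ne', iterate_succ_apply, iterate_succ_apply, hij]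
  have hτ : ∀ i, f (σ'.symm (σ i)) = f i := fun i => by
    apply hinj
    have h1 := itinerary_apply σ' ε (σ'.symm (σ i))
    rw [← hf, Equiv.apply_symm_apply] at h1
    rw [← h1, hfdef, itinerary_apply]
  -- This map preserves itineraries, so it can only fail to be monotone on two points with the same
  -- itinerary. There `σ` and `σ'` both preserve or both reverse order, according to the common
  -- sign.
  have hmono : StrictMono (σ.trans σ'.symm) := by
    intro i j hij
    rw [Equiv.trans_apply, Equiv.trans_apply]
    by_contra hlt
    have hle := not_lt.1 hlt
    have h1 := h.monotone_itinerary hle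
    have h2 := h.monotone_itinerary hij.le
    simp only [← hfdef, hτ] at h1 h2
    have heq : f i = f j := toLex.injective (le_antisymm h2 h1)
    have hne : σ'.symm (σ j) ≠ σ'.symm (σ i) := fun he => hij.ne' (σ.injective (σ'.symm.injective he))
    have hlt' := lt_of_le_of_ne hle hne
    have h0 : ∀ k, ε (σ'.symm (σ k)) = ε k := fun k => congrFun (hτ k) 0
    have h0' : ε i = ε j := congrFun heq 0
    cases hb : ε i with
    | false =>
      have h3 := h'.lt_of_false hlt' (by rw [h0, hb])
      rw [Equiv.apply_symm_apply, Equiv.apply_symm_apply] at h3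
      exact lt_asymm h3 (h.lt_of_false hij (h0' ▸ hb))
    | true =>
      have h3 := h'.lt_of_true hlt' (by rw [h0, ← h0', hb])
      rw [Equiv.apply_symm_apply, Equiv.apply_symm_apply] at h3
      exact lt_asymm h3 (h.lt_of_true hij hb)
  have h1 := perm_eq_one_of_strictMono hmono
  ext i
  rw [← σ'.apply_symm_apply (σ i)]
  exact congrArg (fun k => (σ' k).val) (DFunLike.congr_fun h1 i)

/-! ### Building a signed permutation from multiplicities -/

theorem toLex_lt_iff {x y : ℕ → Bool} :
    toLex x < toLex y ↔ ∃ r, (∀ l < r, x l = y l) ∧ x r = false ∧ y r = true :=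
  exists_congr fun _ => and_congr Iff.rfl Bool.lt_iff

theorem apply_zero_le_of_toLex_le {x y : ℕ → Bool} (h : toLex x ≤ toLex y) : x 0 ≤ y 0 := by
  rcases h.eq_or_lt with h | h
  · rw [toLex.injective h]
  · obtain ⟨r, hr, h1, h2⟩ := toLex_lt_iff.1 h
    rcases Nat.eq_zero_or_pos r with rfl | h0
    · rw [h1]; exact Bool.false_le _
    · exact (hr 0 h0).le

theorem tent_lt_tent_of_false {x y : ℕ → Bool} (h : toLex x < toLex y) (hy : y 0 = false) :
    toLex (tent x) < toLex (tent y) := by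
  obtain ⟨r, hr, h1, h2⟩ := toLex_lt_iff.1 h
  obtain _ | r := r
  · simp [hy] at h2
  · have hx : x 0 = false := by rw [hr 0 r.succ_pos, hy]
    refine toLex_lt_iff.2 ⟨r, fun l hl => ?_, ?_, ?_⟩ <;> simp only [tent, hx, hy, Bool.xor_false]
    exacts [hr _ (Nat.succ_lt_succ hl), h1, h2]

theorem tent_lt_tent_of_true {x y : ℕ → Bool} (h : toLex x < toLex y) (hx : x 0 = true) :
    toLex (tent y) < toLex (tent x) := by
  obtain ⟨r, hr, h1, h2⟩ := toLex_lt_iff.1 h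
  obtain _ | r := r
  · simp [hx] at h1
  · have hy : y 0 = true := by rw [← hr 0 r.succ_pos, hx]
    refine toLex_lt_iff.2 ⟨r, fun l hl => ?_, ?_, ?_⟩ <;>
      simp only [tent, hx, hy, Bool.xor_true, h1, h2, Bool.not_true, Bool.not_false]
    rw [hr _ (Nat.succ_lt_succ hl)]

/-- `a x` copies of each point `x` of period `m`, arranged in lexicographic order. -/
def TentStack {m : ℕ} (a : TentPt m → ℕ) : Type := Σ x : TentPt m, Fin (a x)

namespace TentStack

variable {m : ℕ} {a : TentPt m → ℕ}

/-- The embedding of the stack in a lexicographic product. -/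
def key (p : TentStack a) : Lex (ℕ → Bool) ×ₗ ℕ := toLex (toLex p.1.1, p.2.1)

theorem ext' {p q : TentStack a} (h1 : p.1 = q.1) (h2 : (p.2 : ℕ) = q.2) : p = q := by
  obtain ⟨x, i⟩ := p
  obtain ⟨y, j⟩ := q
  obtain rfl : x = y := h1
  obtain rfl : i = j := Fin.ext h2
  rfl

theorem key_injective : Injective (key (a := a)) := fun p q h => by
  have h' : (toLex p.1.1, (p.2 : ℕ)) = (toLex q.1.1, (q.2 : ℕ)) := toLex.injective h
  rw [Prod.mk.injEq] at h'
  exact ext' (Subtype.ext (toLex.injective h'.1)) h'.2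

noncomputable instance : LinearOrder (TentStack a) := LinearOrder.lift' key key_injective

theorem lt_iff {p q : TentStack a} :
    p < q ↔ toLex p.1.1 < toLex q.1.1 ∨ p.1 = q.1 ∧ (p.2 : ℕ) < q.2 := by
  change key p < key q ↔ _
  rw [key, key, Prod.Lex.toLex_lt_toLex, Subtype.ext_iff]
  rfl

theorem toLex_le_of_le {p q : TentStack a} (h : p ≤ q) : toLex p.1.1 ≤ toLex q.1.1 := by
  rcases h.eq_or_lt with rfl | h
  · exact le_rfl
  · rcases lt_iff.1 h with h | h
    · exact h.le
    · rw [h.1]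

/-- The tent map on the stack: it reverses the copies of `x` when `x` starts with `true`. -/
def map (hm : 0 < m) (ha : ∀ x, a (tentPerm hm x) = a x) (p : TentStack a) : TentStack a :=
  ⟨tentPerm hm p.1, (if p.1.1 0 then p.2.rev else p.2).cast (ha p.1).symm⟩

theorem map_snd (hm : 0 < m) (ha : ∀ x, a (tentPerm hm x) = a x) (p : TentStack a) :
    ((map hm ha p).2 : ℕ) = if p.1.1 0 then a p.1 - 1 - p.2 else p.2 := by
  simp only [map, Fin.val_cast]
  split_ifs
  · rw [Fin.val_rev]; omega
  · rfl

theorem map_injective (hm : 0 < m) (ha : ∀ x, a (tentPerm hm x) = a x) :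
    Injective (map hm ha) := by
  intro p q h
  have h1 : p.1 = q.1 := (tentPerm hm).injective (congrArg Sigma.fst h)
  have h2 : ((map hm ha p).2 : ℕ) = (map hm ha q).2 := by rw [h]
  have h3 : a p.1 = a q.1 := congrArg a h1
  have h4 : p.1.1 0 = q.1.1 0 := by rw [h1]
  rw [map_snd, map_snd, h4] at h2
  have hp := p.2.2
  have hq := q.2.2
  refine ext' h1 ?_
  split_ifs at h2 <;> omega

theorem iterate_map (hm : 0 < m) (ha : ∀ x, a (tentPerm hm x) = a x) (l : ℕ) (p : TentStack a) :
    (((map hm ha)^[l] p).1 = (tentPerm hm)^[l] p.1) ∧ a ((map hm ha)^[l] p).1 = a p.1 := by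
  induction l with
  | zero => exact ⟨rfl, rfl⟩
  | succ l ih =>
    rw [iterate_succ_apply', iterate_succ_apply', ← ih.1]
    exact ⟨rfl, (ha _).trans ih.2⟩

theorem iterate_map_snd (hm : 0 < m) (ha : ∀ x, a (tentPerm hm x) = a x) (l : ℕ)
    (p : TentStack a) :
    (((map hm ha)^[l + 1] p).2 : ℕ) = if p.1.1 l then a p.1 - 1 - p.2 else p.2 := by
  induction l with
  | zero => exact map_snd hm ha p
  | succ l ih =>
    have hp := p.2.2
    have h := iterate_map hm ha (l + 1) p
    rw [iterate_succ_apply', map_snd, ih, h.2, h.1, tentPerm_iterate_val, tent_iterate_succ,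
      zero_add]
    cases p.1.1 (l + 1) <;> cases p.1.1 l <;> simp
    -- The remaining case has two reversals, which cancel.
    omega

/-- The `m`-th iterate reverses the copies of `x` exactly when `x (m - 1)` is true, and reversing at
most one copy changes nothing. -/
theorem iterate_map_eq_self (hm : 0 < m) (ha : ∀ x, a (tentPerm hm x) = a x)
    (ha' : ∀ x : TentPt m, x.1 (m - 1) = true → a x ≤ 1) (p : TentStack a) :
    (map hm ha)^[m] p = p := by
  refine ext' ?_ ?_
  · rw [(iterate_map hm ha m p).1]
    exact Subtype.ext (by rw [tentPerm_iterate_val, p.1.2])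
  · obtain ⟨k, rfl⟩ := Nat.exists_eq_add_of_lt hm
    rw [zero_add] at *
    rw [iterate_map_snd]
    split_ifs with h
    · have := ha' p.1 h
      have := p.2.2
      omega
    · rfl

theorem isSigned_map {hm : 0 < m} {ha : ∀ x, a (tentPerm hm x) = a x}
    {σ : Perm (TentStack a)} (hσ : ∀ p, σ p = map hm ha p) :
    IsSigned σ fun p => p.1.1 0 where
  mono p q h := apply_zero_le_of_toLex_le (toLex_le_of_le h)
  lt_of_false p q h hq := by
    rw [hσ, hσ, lt_iff]
    rcases lt_iff.1 h with h | h
    · exact .inl (tent_lt_tent_of_false h hq)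
    · refine .inr ⟨congrArg (tentPerm hm) h.1, ?_⟩
      have hp : p.1.1 0 = false := by rw [h.1, hq]
      rw [map_snd, map_snd, hp, hq]
      simpa using h.2
  lt_of_true p q h hp := by
    rw [hσ, hσ, lt_iff]
    rcases lt_iff.1 h with h | h
    · exact .inl (tent_lt_tent_of_true h hp)
    · refine .inr ⟨congrArg (tentPerm hm) h.1.symm, ?_⟩
      have h1 := q.2.2
      have h2 := h.2
      have h3 : a p.1 = a q.1 := congrArg a h.1
      have hq : q.1.1 0 = true := by rw [← h.1, hp]
      rw [map_snd, map_snd, hp, hq]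
      simp only [if_true]
      omega

end TentStack

theorem IsSigned.of_orderIso {α β : Type*} [LinearOrder α] [LinearOrder β] (e : α ≃o β)
    {σ : Perm β} {ε : β → Bool} (h : IsSigned σ ε) :
    IsSigned ((e.toEquiv.trans σ).trans e.symm.toEquiv) (fun i => ε (e i)) where
  mono _ _ hij := h.mono (e.monotone hij)
  lt_of_false _ _ hij hj := e.symm.strictMono (h.lt_of_false (e.strictMono hij) hj)
  lt_of_true _ _ hij hi := e.symm.strictMono (h.lt_of_true (e.strictMono hij) hi)

/-! ### The bijection between signed roots and multiplicities -/

/-- Signed permutations of `Fin n` of order dividing `m`. -/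
abbrev SignedRoot (m n : ℕ) : Type :=
  {p : Perm (Fin n) × (Fin n → Bool) // IsSigned p.1 p.2 ∧ p.1 ^ m = 1}

/-- Multiplicity functions of multisets of itineraries. -/
abbrev TentMultiplicity {m : ℕ} (hm : 0 < m) [Fintype (TentPt m)] (n : ℕ) : Type :=
  {a : TentPt m → ℕ // (∀ x, a (tentPerm hm x) = a x) ∧
    (∀ x : TentPt m, x.1 (m - 1) = true → a x ≤ 1) ∧ ∑ x, a x = n}

/-- The itinerary of an element under a permutation of order dividing `m`. -/
def SignedRoot.code {m n : ℕ} (p : SignedRoot m n) (i : Fin n) : TentPt m :=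
  ⟨itinerary p.1.1 p.1.2 i, by
    rw [← itinerary_iterate, ← Perm.coe_pow, p.2.2, Perm.one_apply]⟩

theorem SignedRoot.code_apply {m n : ℕ} (hm : 0 < m) (p : SignedRoot m n) (i : Fin n) :
    p.code (p.1.1 i) = tentPerm hm (p.code i) :=
  Subtype.ext (itinerary_apply _ _ i)

/-- The multiplicities of the itineraries of a signed permutation. -/
noncomputable def SignedRoot.multiplicity {m n : ℕ} (hm : 0 < m) [Fintype (TentPt m)]
    (p : SignedRoot m n) : TentMultiplicity hm n :=
  ⟨fun x => Nat.card {i // p.code i = x}, by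
    refine ⟨fun x => ?_, fun x hx => ?_, ?_⟩
    · refine (Nat.card_congr (p.1.1.subtypeEquiv fun i => ?_)).symm
      rw [p.code_apply hm, (tentPerm hm).apply_eq_iff_eq]
    · rw [Finite.card_le_one_iff_subsingleton]
      refine ⟨fun i j => ?_⟩
      -- Two points sharing an odd code would be exchanged in order by `σ ^ m`, which is the
      -- identity.
      have key : ∀ i j : {i // p.code i = x}, ¬ i.1 < j.1 := fun i j hij => by
        have h1 := p.2.1.iterate_lt (m - 1) hij (congrArg Subtype.val (i.2.trans j.2.symm))
        have h2 : itinerary p.1.1 p.1.2 i.1 (m - 1) = true := by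
          rw [← hx]; exact congrFun (congrArg Subtype.val i.2) (m - 1)
        rw [if_pos h2, Nat.sub_add_cancel hm, ← Perm.coe_pow, p.2.2] at h1
        exact lt_asymm hij h1
      exact Subtype.ext (le_antisymm (not_lt.1 (key j i)) (not_lt.1 (key i j)))
    · rw [← Nat.card_sigma, Nat.card_congr (Equiv.sigmaFiberEquiv p.code), Nat.card_fin]⟩

theorem SignedRoot.multiplicity_injective {m n : ℕ} (hm : 0 < m) [Fintype (TentPt m)] :
    Injective (SignedRoot.multiplicity (n := n) hm) := by
  intro p q h
  have hpq : (fun i => toLex (itinerary p.1.1 p.1.2 i)) =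
      fun i => toLex (itinerary q.1.1 q.1.2 i) := by
    have hcode : ∀ (r : SignedRoot m n) (x : TentPt m),
        Nat.card {i // toLex (itinerary r.1.1 r.1.2 i) = toLex x.1} = (r.multiplicity hm).1 x :=
      fun r x => Nat.card_congr (Equiv.subtypeEquivRight fun i => by
        rw [toLex.apply_eq_iff_eq, Subtype.ext_iff]; rfl)
    refine eq_of_monotone_of_card_fiber_eq p.2.1.monotone_itinerary q.2.1.monotone_itinerary
      fun y => ?_
    -- The multiplicities only see sequences of period `m`; over any other sequence both fibers are
    -- empty.
    by_cases hy : tent^[m] (ofLex y) = ofLex y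
    · exact (hcode p ⟨ofLex y, hy⟩).trans
        ((congrFun (congrArg Subtype.val h) _).trans (hcode q ⟨ofLex y, hy⟩).symm)
    · have : ∀ r : SignedRoot m n, IsEmpty {i // toLex (itinerary r.1.1 r.1.2 i) = y} :=
        fun r => ⟨fun i => hy (by rw [← i.2]; exact (r.code i.1).2)⟩
      have hp := this p
      have hq := this q
      rw [Nat.card_of_isEmpty, Nat.card_of_isEmpty]
  have := p.2.1.eq_of_itinerary_eq hm q.2.1 p.2.2
    (funext fun i => toLex.injective (congrFun hpq i))
  exact Subtype.ext (Prod.ext this.1 this.2)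

theorem SignedRoot.multiplicity_surjective {m n : ℕ} (hm : 0 < m) [Fintype (TentPt m)] :
    Surjective (SignedRoot.multiplicity (n := n) hm) := by
  rintro ⟨a, ha, ha', hn⟩
  let _ : Fintype (TentStack a) := inferInstanceAs (Fintype (Σ x : TentPt m, Fin (a x)))
  have hcard : Fintype.card (TentStack a) = n := by
    rw [← hn]
    exact (Fintype.card_sigma (α := fun x : TentPt m => Fin (a x))).trans (by simp)
  let e : Fin n ≃o TentStack a := Fintype.orderIsoFinOfCardEq _ hcard
  let σ : Perm (TentStack a) :=
    Equiv.ofBijective _ (Finite.injective_iff_bijective.1 (TentStack.map_injective hm ha))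
  have hσ : ∀ p, σ p = TentStack.map hm ha p := fun p => rfl
  let σ' : Perm (Fin n) := (e.toEquiv.trans σ).trans e.symm.toEquiv
  have hσ' : ∀ i, e (σ' i) = TentStack.map hm ha (e i) := fun i => e.apply_symm_apply _
  have hs : IsSigned σ' fun i => (e i).1.1 0 := (TentStack.isSigned_map hσ).of_orderIso e
  have hpow : σ' ^ m = 1 := by
    ext i
    have : e (σ'^[m] i) = (TentStack.map hm ha)^[m] (e i) :=
      (Function.Semiconj.iterate_right (f := e) (ga := σ') (gb := TentStack.map hm ha) hσ' m) i
    rw [TentStack.iterate_map_eq_self hm ha ha'] at this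
    rw [Perm.coe_pow, e.injective this, Perm.one_apply]
  refine ⟨⟨(σ', fun i => (e i).1.1 0), hs, hpow⟩, Subtype.ext (funext fun x => ?_)⟩
  -- The code attached to a stack element is its actual itinerary, by uniqueness of codings that
  -- intertwine `σ'` with the tent map.
  have hit : (fun i => (e i).1.1) = itinerary σ' fun i => (e i).1.1 0 :=
    eq_itinerary (fun i => by rw [hσ']; rfl) fun _ => rfl
  calc _ = Nat.card {p : Sigma fun x : TentPt m => Fin (a x) // p.1 = x} :=
        Nat.card_congr (e.toEquiv.subtypeEquiv fun i => by
          rw [Subtype.ext_iff, Subtype.ext_iff]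
          exact Eq.congr_left (congrFun hit i).symm)
    _ = a x := by rw [Nat.card_congr (Equiv.sigmaSubtype x), Nat.card_fin]

theorem card_signedRoot {m : ℕ} (hm : 0 < m) [Fintype (TentPt m)] (n : ℕ) :
    Nat.card (SignedRoot m n) = Nat.card (TentMultiplicity hm n) :=
  Nat.card_congr (Equiv.ofBijective _
    ⟨SignedRoot.multiplicity_injective hm, SignedRoot.multiplicity_surjective hm⟩)

theorem card_signedRoot_zero (m : ℕ) : Nat.card (SignedRoot m 0) = 1 := by
  rw [Nat.card_eq_one_iff_unique]
  exact ⟨inferInstance, ⟨⟨(1, fun _ => false), ⟨fun i => i.elim0, fun i => i.elim0,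
    fun i => i.elim0⟩, one_pow m⟩⟩⟩

/-! ### Unimodal permutations and the sign at the peak -/

/-- The position of the maximum of a permutation. -/
def peak {n : ℕ} (σ : Perm (Fin (n + 1))) : Fin (n + 1) := σ.symm (Fin.last n)

theorem lt_apply_peak {n : ℕ} (σ : Perm (Fin (n + 1))) {i : Fin (n + 1)} (hi : i ≠ peak σ) :
    σ i < σ (peak σ) := by
  rw [peak, σ.apply_symm_apply]
  exact Fin.lt_last_iff_ne_last.2 fun h => hi (by rw [peak, ← h, σ.symm_apply_apply])

theorem IsUnimodal.peak_eq {n : ℕ} {σ : Perm (Fin (n + 1))} {k : Fin (n + 1)}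
    (h1 : StrictMonoOn σ (Set.Iic k)) (h2 : StrictAntiOn σ (Set.Ici k)) : k = peak σ := by
  by_contra hk
  have := lt_apply_peak σ hk
  rcases le_total (peak σ) k with h | h
  · exact not_le.2 this (h1.monotoneOn h Set.self_mem_Iic h)
  · exact not_le.2 this (h2.antitoneOn Set.self_mem_Ici h h)

theorem IsSigned.eq_false_of_lt_peak {n : ℕ} {σ : Perm (Fin (n + 1))} {ε : Fin (n + 1) → Bool}
    (h : IsSigned σ ε) {i : Fin (n + 1)} (hi : i < peak σ) : ε i = false :=
  Bool.eq_false_iff.2 fun hε => lt_asymm (h.lt_of_true hi hε) (lt_apply_peak σ hi.ne)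

theorem IsSigned.eq_true_of_peak_lt {n : ℕ} {σ : Perm (Fin (n + 1))} {ε : Fin (n + 1) → Bool}
    (h : IsSigned σ ε) {i : Fin (n + 1)} (hi : peak σ < i) : ε i = true := by
  by_contra hε
  exact lt_asymm (h.lt_of_false hi (Bool.eq_false_iff.2 hε)) (lt_apply_peak σ hi.ne')

theorem IsSigned.isUnimodal {n : ℕ} {σ : Perm (Fin (n + 1))} {ε : Fin (n + 1) → Bool}
    (h : IsSigned σ ε) : IsUnimodal σ := by
  refine ⟨peak σ, fun i _ j hj hij => ?_, fun i hi j _ hij => ?_⟩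
  · rcases (Set.mem_Iic.1 hj).eq_or_lt with rfl | hj
    · exact lt_apply_peak σ hij.ne
    · exact h.lt_of_false hij (h.eq_false_of_lt_peak hj)
  · rcases (Set.mem_Ici.1 hi).eq_or_lt with rfl | hi
    · exact lt_apply_peak σ hij.ne'
    · exact h.lt_of_true hij (h.eq_true_of_peak_lt hi)

/-- The signs of a unimodal permutation with a given sign at the peak. -/
def peakSign {n : ℕ} (σ : Perm (Fin (n + 1))) (b : Bool) (i : Fin (n + 1)) : Bool :=
  if i < peak σ then false else if i = peak σ then b else true

theorem IsSigned.eq_peakSign {n : ℕ} {σ : Perm (Fin (n + 1))} {ε : Fin (n + 1) → Bool}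
    (h : IsSigned σ ε) : ε = peakSign σ (ε (peak σ)) := by
  funext i
  rw [peakSign]
  split_ifs with h1 h2
  · exact h.eq_false_of_lt_peak h1
  · rw [h2]
  · exact h.eq_true_of_peak_lt (lt_of_le_of_ne (not_lt.1 h1) (Ne.symm h2))

theorem IsUnimodal.isSigned {n : ℕ} {σ : Perm (Fin (n + 1))} (h : IsUnimodal σ) (b : Bool) :
    IsSigned σ (peakSign σ b) := by
  obtain ⟨k, h1, h2⟩ := h
  obtain rfl := IsUnimodal.peak_eq h1 h2
  refine ⟨fun i j hij => ?_, fun i j hij hj => ?_, fun i j hij hi => ?_⟩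
  · simp only [peakSign]
    split_ifs <;> first | exact le_rfl | exact Bool.false_le _ | exact Bool.le_true _ | omega
  · have hj' : j ≤ peak σ := by
      by_contra hc
      have hc := not_le.1 hc
      simp [peakSign, hc.not_gt, hc.ne'] at hj
    exact h1 (Set.mem_Iic.2 (hij.le.trans hj')) (Set.mem_Iic.2 hj') hij
  · have hi' : peak σ ≤ i := by
      by_contra hc
      simp [peakSign, not_le.1 hc] at hi
    exact h2 (Set.mem_Ici.2 hi') (Set.mem_Ici.2 (hi'.trans hij.le)) hij

/-- A signed permutation is a unimodal permutation with an arbitrary sign at the peak. -/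
def signedRootEquiv (m n : ℕ) : SignedRoot m (n + 1) ≃
    {σ : Perm (Fin (n + 1)) // IsUnimodal σ ∧ σ ^ m = 1} × Bool where
  toFun p := (⟨p.1.1, p.2.1.isUnimodal, p.2.2⟩, p.1.2 (peak p.1.1))
  invFun q := ⟨(q.1.1, peakSign q.1.1 q.2), q.1.2.1.isSigned q.2, q.1.2.2⟩
  left_inv p := Subtype.ext (Prod.ext rfl p.2.1.eq_peakSign.symm)
  right_inv q := Prod.ext rfl (by simp [peakSign])

theorem card_signedRoot_succ (m n : ℕ) :
    Nat.card (SignedRoot m (n + 1)) = 2 * unimodalRootCount m (n + 1) := by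
  rw [Nat.card_congr (signedRootEquiv m n), Nat.card_prod, unimodalRootCount, mul_comm]
  simp

/-! ### Orbits of a permutation -/

section Orbits

variable {X : Type*} (T : Perm X)

/-- The set of orbits of a permutation. -/
abbrev PermOrbit : Type _ := MulAction.orbitRel.Quotient (Subgroup.zpowers T) X

/-- The orbit of a point. -/
def permOrbit (x : X) : PermOrbit T := Quotient.mk _ x

theorem permOrbit_surjective : Surjective (permOrbit T) := Quotient.mk_surjective

theorem permOrbit_eq_iff {x y : X} :
    permOrbit T x = permOrbit T y ↔ x ∈ MulAction.orbit (Subgroup.zpowers T) y :=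
  Quotient.eq.trans MulAction.orbitRel_apply

theorem permOrbit_apply (x : X) : permOrbit T (T x) = permOrbit T x :=
  (permOrbit_eq_iff T).2 ⟨⟨T, Subgroup.mem_zpowers T⟩, rfl⟩

variable {T}

theorem eq_of_permOrbit_eq {γ : Type*} {f : X → γ} (h : ∀ x, f (T x) = f x) {x y : X}
    (hxy : permOrbit T x = permOrbit T y) : f x = f y := by
  obtain ⟨⟨g, hg⟩, rfl⟩ := (permOrbit_eq_iff T).1 hxy
  obtain ⟨z, rfl⟩ := Subgroup.mem_zpowers_iff.1 hg
  change f ((T ^ z) y) = f y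
  clear hg hxy
  induction z generalizing y with
  | zero => rfl
  | succ i ih => rw [zpow_add_one, Perm.mul_apply, ih, h]
  | pred i ih =>
    rw [zpow_sub_one, Perm.mul_apply, ih, ← h]
    exact congrArg f (T.apply_symm_apply y)

theorem card_permOrbit_fiber [Finite X] (x : X) :
    Nat.card {y // permOrbit T y = permOrbit T x} = minimalPeriod T x := by
  classical
  have := Fintype.ofFinite X
  have h := MulAction.minimalPeriod_eq_card (a := T) (b := x)
  refine Eq.trans ?_ (h.symm.trans rfl)
  rw [← Nat.card_eq_fintype_card]
  exact Nat.card_congr (Equiv.subtypeEquivRight fun y => permOrbit_eq_iff T)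

/-- Invariant functions are functions on the set of orbits. -/
noncomputable def invariantEquiv (T : Perm X) (γ : Type*) :
    {f : X → γ // ∀ x, f (T x) = f x} ≃ (PermOrbit T → γ) where
  toFun f := Quotient.lift f.1 fun _ _ h => eq_of_permOrbit_eq f.2 (Quotient.sound h)
  invFun g := ⟨fun x => g (permOrbit T x), fun x => congrArg g (permOrbit_apply T x)⟩
  left_inv f := rfl
  right_inv g := funext fun w => by
    obtain ⟨x, rfl⟩ := permOrbit_surjective T w
    rfl

end Orbits

/-! ### Generating functions -/

-- Each factor is the indicator series of the weights `w ω * k` with `k` allowed. As `w ω > 0`, the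
-- exponents chosen in the factors recover the multiplicities.
open PowerSeries in
theorem coeff_prod_indicator {Ω : Type*} [Fintype Ω] (w : Ω → ℕ) (hw : ∀ ω, 0 < w ω)
    (A : Ω → ℕ → Prop) (F : Ω → PowerSeries ℚ) (hF : ∀ ω k, A ω k → coeff (w ω * k) (F ω) = 1)
    (hF' : ∀ ω l, (∀ k, A ω k → l ≠ w ω * k) → coeff l (F ω) = 0) (n : ℕ) :
    coeff n (∏ ω, F ω) = Nat.card {b : Ω → ℕ // (∀ ω, A ω (b ω)) ∧ ∑ ω, w ω * b ω = n} := by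
  classical
  have hc : ∀ ω l, coeff l (F ω) = if ∃ k, A ω k ∧ l = w ω * k then 1 else 0 := by
    intro ω l
    split_ifs with h
    · obtain ⟨k, hk, rfl⟩ := h
      exact hF ω k hk
    · exact hF' ω l fun k hk hl => h ⟨k, hk, hl⟩
  rw [coeff_prod]
  simp only [hc, Finset.prod_ite_zero, Finset.prod_const_one, Finset.sum_boole]
  congr 1
  rw [← Nat.card_eq_finsetCard]
  symm
  refine Nat.card_eq_of_bijective
    (fun b => ⟨Finsupp.equivFunOnFinite.symm fun ω => w ω * b.1 ω, ?_⟩) ⟨?_, ?_⟩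
  · simp only [Finset.mem_filter, Finset.mem_finsuppAntidiag, Finset.subset_univ, and_true]
    exact ⟨b.2.2, fun ω _ => ⟨b.1 ω, b.2.1 ω, rfl⟩⟩
  · intro b b' h
    have h1 := Finsupp.equivFunOnFinite.symm.injective (congrArg Subtype.val h)
    exact Subtype.ext (funext fun ω => Nat.eq_of_mul_eq_mul_left (hw ω) (congrFun h1 ω))
  · rintro ⟨l, hl⟩
    simp only [Finset.mem_filter, Finset.mem_finsuppAntidiag, Finset.subset_univ, and_true] at hl
    choose b hb hb' using fun ω => hl.2 ω (Finset.mem_univ ω)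
    refine ⟨⟨b, hb, ?_⟩, Subtype.ext (Finsupp.ext fun ω => (hb' ω).symm)⟩
    rw [← hl.1]
    exact Finset.sum_congr rfl fun ω _ => (hb' ω).symm

open PowerSeries in
theorem constantCoeff_one_sub_X_pow {d : ℕ} (hd : 0 < d) :
    constantCoeff (1 - (X : PowerSeries ℚ) ^ d) = 1 := by
  simp [hd.ne']

open PowerSeries in
theorem inv_one_sub_X_pow {d : ℕ} (hd : 0 < d) :
    (1 - (X : PowerSeries ℚ) ^ d)⁻¹ = mk fun l => if d ∣ l then 1 else 0 := by
  rw [PowerSeries.inv_eq_iff_mul_eq_one (by rw [constantCoeff_one_sub_X_pow hd]; exact one_ne_zero)]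
  ext n
  rw [mul_sub, mul_one, map_sub, coeff_mk, coeff_mul_X_pow', coeff_one]
  rcases lt_or_ge n d with h | h
  · have : d ∣ n ↔ n = 0 := ⟨fun h' => Nat.eq_zero_of_dvd_of_lt h' h, fun h' => h' ▸ dvd_zero d⟩
    simp [this, h.not_ge]
  · have : d ∣ n - d ↔ d ∣ n := Nat.dvd_sub_self_right.trans (or_iff_left_of_imp fun h' =>
      (le_antisymm h h').dvd)
    simp [this, h, (hd.trans_le h).ne']

/-! ### Counting periodic points of the tent map -/

/-- The number of points of minimal period `d` and given parity. -/
noncomputable def tentCount (d : ℕ) (b : Bool) : ℕ :=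
  Nat.card {y : ℕ → Bool // minimalPeriod tent y = d ∧ y (d - 1) = b}

theorem iterate_eq_of_minimalPeriod_eq {α : Type*} {f : α → α} {x : α} {d : ℕ}
    (h : minimalPeriod f x = d) : f^[d] x = x := by
  rw [← h]
  exact iterate_minimalPeriod

theorem tent_last_of_dvd {d m : ℕ} (hm : 0 < m) (hd : d ∣ m) {y : ℕ → Bool}
    (hy : minimalPeriod tent y = d) : y (m - 1) = (decide (Odd (m / d)) && y (d - 1)) := by
  have hy := iterate_eq_of_minimalPeriod_eq hy
  obtain ⟨q, rfl⟩ := hd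
  obtain ⟨k, rfl⟩ := Nat.exists_eq_succ_of_ne_zero (pos_of_mul_pos_left hm q.zero_le).ne'
  obtain ⟨q, rfl⟩ := Nat.exists_eq_succ_of_ne_zero (pos_of_mul_pos_right hm k.succ.zero_le).ne'
  rw [Nat.mul_div_cancel_left _ k.succ_pos, mul_comm]
  exact tent_last_mul hy q

/-- The number of points of period `m` having minimal period `d` and given parity. -/
noncomputable def tentPtCount (m d : ℕ) (b : Bool) : ℕ :=
  Nat.card {x : TentPt m // minimalPeriod tent x.1 = d ∧ x.1 (m - 1) = b}

theorem finite_minimalPeriod {d : ℕ} (hd : 0 < d) (b : Bool) :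
    Finite {y : ℕ → Bool // minimalPeriod tent y = d ∧ y (d - 1) = b} := by
  have := finite_tentPt hd
  refine Finite.of_injective (β := TentPt d)
    (fun y => ⟨y.1, iterate_eq_of_minimalPeriod_eq y.2.1⟩)
    fun y z h => Subtype.ext (congrArg (fun t : TentPt d => t.1) h)

theorem tentPtCount_eq_card {m d : ℕ} (hd : d ∣ m) (b : Bool) :
    tentPtCount m d b = Nat.card {y : ℕ → Bool // minimalPeriod tent y = d ∧ y (m - 1) = b} :=
  Nat.card_congr
    { toFun := fun x => ⟨x.1.1, x.2⟩
      invFun := fun y => ⟨⟨y.1, isPeriodicPt_iff_minimalPeriod_dvd.2 (y.2.1.symm ▸ hd)⟩, y.2⟩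
      left_inv := fun _ => rfl
      right_inv := fun _ => rfl }

theorem tentPtCount_of_odd {m d : ℕ} (hm : 0 < m) (hd : d ∣ m) (h : Odd (m / d)) (b : Bool) :
    tentPtCount m d b = tentCount d b := by
  rw [tentPtCount_eq_card hd]
  refine Nat.card_congr (Equiv.subtypeEquivRight fun y => and_congr_right fun hy => ?_)
  rw [tent_last_of_dvd hm hd hy]
  simp [h]

theorem tentPtCount_true_of_even {m d : ℕ} (hm : 0 < m) (hd : d ∣ m) (h : ¬ Odd (m / d)) :
    tentPtCount m d true = 0 := by
  rw [tentPtCount_eq_card hd, Nat.card_eq_zero]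
  refine .inl ⟨fun y => ?_⟩
  have := y.2.2
  rw [tent_last_of_dvd hm hd y.2.1] at this
  simp [h] at this

theorem tentPtCount_false_of_even {m d : ℕ} (hm : 0 < m) (hd : d ∣ m) (h : ¬ Odd (m / d)) :
    tentPtCount m d false = tentCount d false + tentCount d true := by
  classical
  have hd0 := Nat.pos_of_dvd_of_pos hd hm
  have := finite_minimalPeriod hd0 false
  have := finite_minimalPeriod hd0 true
  rw [tentPtCount_eq_card hd, tentCount, tentCount, ← Nat.card_sum]
  refine Nat.card_congr (Equiv.trans (Equiv.subtypeEquivRight fun y => ?_)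
    (subtypeOrEquiv _ _ (Pi.disjoint_iff.2 fun y => Prop.disjoint_iff.2 ?_)))
  · constructor
    · rintro ⟨h1, -⟩
      cases hb : y (d - 1)
      exacts [.inl ⟨h1, rfl⟩, .inr ⟨h1, rfl⟩]
    · intro h1
      have h1 : minimalPeriod tent y = d := h1.elim And.left And.left
      refine ⟨h1, ?_⟩
      rw [tent_last_of_dvd hm hd h1]
      simp [h]
  · rintro ⟨⟨-, h1⟩, -, h2⟩
    simp [h1] at h2

theorem sum_tentPtCount {m : ℕ} (hm : 0 < m) (b : Bool) :
    ∑ d ∈ m.divisors, tentPtCount m d b = 2 ^ (m - 1) := by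
  classical
  have := finite_tentPt hm
  have := Fintype.ofFinite (TentPt m)
  have h : Nat.card {x : TentPt m // x.1 (m - 1) = b} = 2 ^ (m - 1) := by
    obtain ⟨k, rfl⟩ := Nat.exists_eq_succ_of_ne_zero hm.ne'
    exact card_tentPt_last_eq k b
  rw [← h, Nat.card_eq_fintype_card, Fintype.card_subtype,
    Finset.card_eq_sum_card_fiberwise (f := fun x : TentPt m => minimalPeriod tent x.1)
      (t := m.divisors)]
  · refine Finset.sum_congr rfl fun d _ => ?_
    rw [tentPtCount, Nat.card_eq_fintype_card, Fintype.card_subtype, Finset.filter_filter]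
    simp only [and_comm]
  · intro x _
    exact Nat.mem_divisors.2 ⟨isPeriodicPt_iff_minimalPeriod_dvd.1 x.2, hm.ne'⟩

theorem sum_tentCount_true {n : ℕ} (hn : 0 < n) :
    ∑ d ∈ n.divisors, (if Odd (n / d) then tentCount d true else 0) = 2 ^ (n - 1) := by
  rw [← sum_tentPtCount hn true]
  refine Finset.sum_congr rfl fun d hd => ?_
  have hd := Nat.dvd_of_mem_divisors hd
  split_ifs with h
  · rw [tentPtCount_of_odd hn hd h]
  · rw [tentPtCount_true_of_even hn hd h]

theorem sum_tentCount_false {n : ℕ} (hn : 0 < n) :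
    ∑ d ∈ n.divisors, (tentCount d false + if Odd (n / d) then 0 else tentCount d true) =
      2 ^ (n - 1) := by
  rw [← sum_tentPtCount hn false]
  refine Finset.sum_congr rfl fun d hd => ?_
  have hd := Nat.dvd_of_mem_divisors hd
  split_ifs with h
  · rw [tentPtCount_of_odd hn hd h, add_zero]
  · rw [tentPtCount_false_of_even hn hd h]

/-- Allows a sum or product over even divisors `2 * d` to be reindexed by the `d` with even
cofactor; this serves both the parity comparison and the final regrouping. -/
theorem filter_two_dvd_divisors {n : ℕ} :
    n.divisors.filter (2 ∣ ·) = (n.divisors.filter fun d => ¬ Odd (n / d)).image (2 * ·) := by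
  ext d
  simp only [Finset.mem_filter, Nat.mem_divisors, Finset.mem_image]
  constructor
  · rintro ⟨⟨⟨k, rfl⟩, h0⟩, e, rfl⟩
    refine ⟨e, ⟨⟨⟨2 * k, by ring⟩, h0⟩, ?_⟩, rfl⟩
    have he : 0 < e := Nat.pos_of_ne_zero fun h => h0 (by simp [h])
    rw [show 2 * e * k = e * (2 * k) by ring, Nat.mul_div_cancel_left _ he]
    simp
  · rintro ⟨e, ⟨⟨⟨k, rfl⟩, h0⟩, h⟩, rfl⟩
    have he : 0 < e := Nat.pos_of_ne_zero fun h => h0 (by simp [h])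
    rw [Nat.mul_div_cancel_left _ he, Nat.not_odd_iff_even] at h
    obtain ⟨j, rfl⟩ := h
    exact ⟨⟨⟨j, by ring⟩, h0⟩, Dvd.intro e rfl⟩

theorem eq_of_sum_divisors_eq {f g : ℕ → ℕ}
    (h : ∀ n, 0 < n → ∑ d ∈ n.divisors, f d = ∑ d ∈ n.divisors, g d) {n : ℕ} (hn : 0 < n) :
    f n = g n := by
  induction n using Nat.strong_induction_on with
  | _ n ih =>
    have := h n hn
    rw [← Nat.cons_self_properDivisors hn.ne', Finset.sum_cons, Finset.sum_cons,
      Finset.sum_congr rfl fun d hd =>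
        ih d (Nat.mem_properDivisors.1 hd).2 (Nat.pos_of_mem_properDivisors hd)] at this
    exact Nat.add_right_cancel this

/-- Both parities have `2 ^ (n - 1)` points of period `n`. Adding the odd points with even `n / d`
to each side completes the sum of odd counts and doubles those terms on the other side; under `d ↦ 2
* d` they become terms at even divisors. -/
theorem tentCount_true_eq {n : ℕ} (hn : 0 < n) :
    tentCount n true = tentCount n false + if 2 ∣ n then 2 * tentCount (n / 2) true else 0 := by
  refine eq_of_sum_divisors_eq
    (f := fun n => tentCount n true)
    (g := fun n => tentCount n false + if 2 ∣ n then 2 * tentCount (n / 2) true else 0)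
    (fun n hn => ?_) hn
  have h1 := sum_tentCount_true hn
  have h2 := sum_tentCount_false hn
  rw [Finset.sum_add_distrib] at h2 ⊢
  have h3 : ∑ d ∈ n.divisors, (if 2 ∣ d then 2 * tentCount (d / 2) true else 0) =
      2 * ∑ d ∈ n.divisors, if Odd (n / d) then 0 else tentCount d true := by
    rw [← Finset.sum_filter, filter_two_dvd_divisors,
      Finset.sum_image fun a _ b _ h => Nat.eq_of_mul_eq_mul_left two_pos h, Finset.mul_sum,
      Finset.sum_filter]
    refine Finset.sum_congr rfl fun d _ => ?_
    split_ifs <;> simp_all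
  have h4 : ∑ d ∈ n.divisors, tentCount d true =
      ∑ d ∈ n.divisors, (if Odd (n / d) then tentCount d true else 0) +
        ∑ d ∈ n.divisors, if Odd (n / d) then 0 else tentCount d true := by
    rw [← Finset.sum_add_distrib]
    refine Finset.sum_congr rfl fun d _ => ?_
    split_ifs <;> simp
  rw [h3, h4]
  omega

open ArithmeticFunction in
theorem tentCount_true_eq_sum {n : ℕ} (hn : 0 < n) :
    (tentCount n true : ℤ) = ∑ d ∈ n.divisors with Odd d, moebius d * 2 ^ (n / d - 1) := by
  let A : ArithmeticFunction ℤ := ⟨fun d => if Odd d then moebius d else 0, by simp⟩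
  let B : ArithmeticFunction ℤ := ⟨fun d => if Odd d then 1 else 0, by simp⟩
  -- An arithmetic function must vanish at 0, hence the guard.
  let C : ArithmeticFunction ℤ := ⟨fun d => if d = 0 then 0 else tentCount d true, by simp⟩
  have hA : ∀ d, A d = if Odd d then moebius d else 0 := fun _ => rfl
  have hB : ∀ d, B d = if Odd d then 1 else 0 := fun _ => rfl
  have hC : ∀ d, 0 < d → C d = tentCount d true := fun d hd => if_neg hd.ne'
  -- A product is odd exactly when both factors are, so restriction to odd arguments preserves `μ *
  -- ζ = 1`.
  have hAB : A * B = 1 := by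
    ext k
    have hk : (A * B) k = if Odd k then (moebius * (zeta : ArithmeticFunction ℤ)) k else 0 := by
      rw [mul_apply, mul_apply]
      split_ifs with h
      · refine Finset.sum_congr rfl fun p hp => ?_
        obtain ⟨rfl, hp0⟩ := Nat.mem_divisorsAntidiagonal.1 hp
        have h' := Nat.odd_mul.1 h
        rw [hA, hB, if_pos h'.1, if_pos h'.2, natCoe_apply,
          zeta_apply_ne (right_ne_zero_of_mul hp0)]
        rfl
      · refine Finset.sum_eq_zero fun p hp => ?_
        obtain ⟨rfl, hp0⟩ := Nat.mem_divisorsAntidiagonal.1 hp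
        rw [Nat.odd_mul, not_and_or] at h
        rw [hA, hB]
        rcases h with h | h <;> simp [h]
    rw [hk, moebius_mul_coe_zeta]
    by_cases h1 : k = 1
    · simp [h1]
    · simp [one_apply_ne h1]
  have hBC : ∀ k, 0 < k → (B * C) k = 2 ^ (k - 1) := fun k hk => by
    rw [mul_apply, Nat.sum_divisorsAntidiagonal' (f := fun i j => B i * C j)]
    have := sum_tentCount_true hk
    zify at this
    rw [← this]
    refine Finset.sum_congr rfl fun d hd => ?_
    rw [hB, hC d (Nat.pos_of_mem_divisors hd)]
    split_ifs <;> simp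
  have h : C n = (A * (B * C)) n := by rw [← mul_assoc, hAB, one_mul]
  rw [hC n hn, mul_apply, Nat.sum_divisorsAntidiagonal (f := fun i j => A i * (B * C) j)] at h
  rw [h, Finset.sum_filter]
  refine Finset.sum_congr rfl fun d hd => ?_
  rw [hA, hBC _ (Nat.div_pos (Nat.divisor_le hd) (Nat.pos_of_mem_divisors hd))]
  split_ifs <;> simp

/-! ### Orbits of points of period `m` -/

section OrbitData

variable {m : ℕ} (hm : 0 < m)

theorem minimalPeriod_tentPerm_apply (x : TentPt m) :
    minimalPeriod (tentPerm hm) (tentPerm hm x) = minimalPeriod (tentPerm hm) x :=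
  minimalPeriod_apply (mk_mem_periodicPts hm (Subtype.ext (by rw [tentPerm_iterate_val, x.2])))

/-- The size of an orbit of the tent map on its points of period `m`. -/
noncomputable def orbitSize : PermOrbit (tentPerm hm) → ℕ :=
  invariantEquiv (tentPerm hm) ℕ ⟨minimalPeriod (tentPerm hm), minimalPeriod_tentPerm_apply hm⟩

/-- The parity of an orbit of the tent map on its points of period `m`. -/
noncomputable def orbitParity : PermOrbit (tentPerm hm) → Bool :=
  invariantEquiv (tentPerm hm) Bool ⟨fun x => x.1 (m - 1), fun x => tent_last_invariant hm x.2⟩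

theorem orbitSize_apply (x : TentPt m) :
    orbitSize hm (permOrbit _ x) = minimalPeriod tent x.1 :=
  minimalPeriod_tentPerm hm x

theorem orbitParity_apply (x : TentPt m) : orbitParity hm (permOrbit _ x) = x.1 (m - 1) := rfl

theorem orbitSize_dvd (w : PermOrbit (tentPerm hm)) : orbitSize hm w ∣ m := by
  obtain ⟨x, rfl⟩ := permOrbit_surjective _ w
  rw [orbitSize_apply]
  exact isPeriodicPt_iff_minimalPeriod_dvd.1 x.2

theorem orbitSize_pos (w : PermOrbit (tentPerm hm)) : 0 < orbitSize hm w :=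
  Nat.pos_of_dvd_of_pos (orbitSize_dvd hm w) hm

theorem card_fiber_permOrbit (w : PermOrbit (tentPerm hm)) :
    Nat.card {x // permOrbit (tentPerm hm) x = w} = orbitSize hm w := by
  have := finite_tentPt hm
  obtain ⟨x, rfl⟩ := permOrbit_surjective _ w
  exact card_permOrbit_fiber x

variable [Fintype (TentPt m)] [Fintype (PermOrbit (tentPerm hm))]

theorem sum_invariant (b : PermOrbit (tentPerm hm) → ℕ) :
    ∑ x, b (permOrbit (tentPerm hm) x) = ∑ w, orbitSize hm w * b w := by
  classical
  rw [← Finset.sum_fiberwise' _ (permOrbit (tentPerm hm)) b]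
  refine Finset.sum_congr rfl fun w _ => ?_
  rw [Finset.sum_const, smul_eq_mul, ← card_fiber_permOrbit, Nat.card_eq_fintype_card,
    Fintype.card_subtype]

/-- Multiplicity functions in terms of orbits. -/
noncomputable def tentMultiplicityEquiv (n : ℕ) : TentMultiplicity hm n ≃
    {b : PermOrbit (tentPerm hm) → ℕ // (∀ w, orbitParity hm w = true → b w ≤ 1) ∧
      ∑ w, orbitSize hm w * b w = n} where
  toFun a := ⟨invariantEquiv _ ℕ ⟨a.1, a.2.1⟩, fun w => by
    obtain ⟨x, rfl⟩ := permOrbit_surjective _ w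
    exact a.2.2.1 x, by
    rw [← sum_invariant]
    exact a.2.2.2⟩
  invFun b := ⟨fun x => b.1 (permOrbit _ x), fun x => congrArg b.1 (permOrbit_apply _ x),
    fun x => b.2.1 (permOrbit _ x), (sum_invariant hm b.1).trans b.2.2⟩
  left_inv a := rfl
  right_inv b := Subtype.ext <| funext fun w => by
    obtain ⟨x, rfl⟩ := permOrbit_surjective _ w
    rfl

/-- Size and parity are constant on orbits, so the points counted on the right split into whole
orbits of `d` points. -/
theorem card_orbits_mul (d : ℕ) (b : Bool) :
    (Finset.univ.filter fun w => orbitSize hm w = d ∧ orbitParity hm w = b).card * d =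
      tentPtCount m d b := by
  classical
  have h : (Finset.univ.filter fun x : TentPt m =>
      minimalPeriod tent x.1 = d ∧ x.1 (m - 1) = b).card = tentPtCount m d b := by
    rw [tentPtCount, Nat.card_eq_fintype_card, Fintype.card_subtype]
  rw [← h, Finset.card_eq_sum_card_fiberwise (f := permOrbit (tentPerm hm))
    (t := Finset.univ.filter fun w => orbitSize hm w = d ∧ orbitParity hm w = b)]
  · rw [← smul_eq_mul, ← Finset.sum_const]
    refine Finset.sum_congr rfl fun w hw => ?_
    obtain ⟨h1, h2⟩ := (Finset.mem_filter.1 hw).2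
    have h3 := card_fiber_permOrbit hm w
    rw [Nat.card_eq_fintype_card, Fintype.card_subtype, h1] at h3
    refine h3.symm.trans ?_
    rw [Finset.filter_filter]
    refine congrArg Finset.card (Finset.filter_congr fun x _ => ?_)
    refine (and_iff_right_of_imp ?_).symm
    rintro rfl
    exact ⟨(orbitSize_apply hm x).symm.trans h1, h2⟩
  · intro x hx
    have := (Finset.mem_filter.1 hx).2
    refine Finset.mem_coe.2 (Finset.mem_filter.2 ⟨Finset.mem_univ _, ?_⟩)
    rwa [orbitSize_apply, orbitParity_apply]

end OrbitData

/-! ### The orbit product and its regrouping -/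

open PowerSeries in
/-- The generating function of multisets of copies of an orbit of size `d`. -/
noncomputable def orbitFactor (d : ℕ) (b : Bool) : PowerSeries ℚ :=
  if b then 1 + X ^ d else (1 - X ^ d)⁻¹

open PowerSeries in
theorem orbitFactor_coeff {d : ℕ} (hd : 0 < d) (b : Bool) :
    (∀ k, (b = true → k ≤ 1) → coeff (d * k) (orbitFactor d b) = 1) ∧
      ∀ l, (∀ k, (b = true → k ≤ 1) → l ≠ d * k) → coeff l (orbitFactor d b) = 0 := by
  cases b with
  | false =>
    simp only [orbitFactor, Bool.false_eq_true, if_false, inv_one_sub_X_pow hd, coeff_mk]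
    exact ⟨fun k _ => if_pos (Dvd.intro k rfl), fun l hl => if_neg fun ⟨k, hk⟩ =>
      hl k (fun h => h.elim) hk⟩
  | true =>
    simp only [orbitFactor, if_true, map_add, coeff_one, coeff_X_pow]
    refine ⟨fun k hk => ?_, fun l hl => ?_⟩
    · have hk : k ≤ 1 := hk trivial
      interval_cases k
      · simp [hd.ne]
      · simp [hd.ne']
    · have h0 := hl 0 (fun _ => Nat.zero_le _)
      have h1 := hl 1 (fun _ => le_rfl)
      rw [mul_zero] at h0
      rw [mul_one] at h1
      simp [h0, h1]

open PowerSeries in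
theorem one_add_two_mul_series_eq_prod_orbits {m : ℕ} (hm : 0 < m)
    [Fintype (PermOrbit (tentPerm hm))] :
    1 + 2 * unimodalRootSeries m = ∏ w, orbitFactor (orbitSize hm w) (orbitParity hm w) := by
  have := finite_tentPt hm
  have := Fintype.ofFinite (TentPt m)
  ext n
  rw [coeff_prod_indicator (orbitSize hm) (orbitSize_pos hm)
    (fun w k => orbitParity hm w = true → k ≤ 1) _
    (fun w => (orbitFactor_coeff (orbitSize_pos hm w) _).1)
    (fun w => (orbitFactor_coeff (orbitSize_pos hm w) _).2),
    ← Nat.card_congr (tentMultiplicityEquiv hm n), ← card_signedRoot hm]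
  have h2 : (2 : PowerSeries ℚ) = C 2 := (map_ofNat C 2).symm
  rw [map_add, h2, coeff_C_mul, unimodalRootSeries, coeff_mk, coeff_one]
  obtain _ | n := n
  · simp [card_signedRoot_zero]
  · simp [card_signedRoot_succ]

theorem prod_orbits {m : ℕ} (hm : 0 < m) [Fintype (PermOrbit (tentPerm hm))] {M : Type*}
    [CommMonoid M] (F : ℕ → Bool → M) :
    ∏ w, F (orbitSize hm w) (orbitParity hm w) = ∏ d ∈ m.divisors,
      (F d true ^ (tentPtCount m d true / d) * F d false ^ (tentPtCount m d false / d)) := by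
  classical
  have := finite_tentPt hm
  have := Fintype.ofFinite (TentPt m)
  rw [← Finset.prod_fiberwise_of_maps_to (t := m.divisors) (g := orbitSize hm)
    fun w _ => Nat.mem_divisors.2 ⟨orbitSize_dvd hm w, hm.ne'⟩]
  refine Finset.prod_congr rfl fun d hd => ?_
  have hcard : ∀ b, ((Finset.univ.filter fun w => orbitSize hm w = d).filter
      fun w => orbitParity hm w = b).card = tentPtCount m d b / d := fun b => by
    rw [← card_orbits_mul hm, Nat.mul_div_cancel _ (Nat.pos_of_mem_divisors hd),
      Finset.filter_filter]
  rw [← Finset.prod_fiberwise _ (orbitParity hm), Fintype.prod_bool, ← hcard, ← hcard]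
  congr 1 <;>
  · refine Finset.prod_eq_pow_card fun w hw => ?_
    rw [Finset.mem_filter, Finset.mem_filter] at hw
    rw [hw.1.2, hw.2]

/-- Taking `m = d` makes the cofactor 1, which is odd, so the count is `d` times a number of orbits.
This makes the natural-number quotients exact and `c_n` an integer. -/
theorem dvd_tentCount {d : ℕ} (hd : 0 < d) (b : Bool) : d ∣ tentCount d b := by
  classical
  have := finite_tentPt hd
  have := Fintype.ofFinite (TentPt d)
  have := Fintype.ofFinite (PermOrbit (tentPerm hd))
  rw [← tentPtCount_of_odd hd dvd_rfl (by rw [Nat.div_self hd]; exact odd_one),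
    ← card_orbits_mul hd]
  exact Nat.dvd_mul_left d _

theorem tentCount_true_div {d : ℕ} (hd : 0 < d) :
    tentCount d true / d =
      tentCount d false / d + if 2 ∣ d then tentCount (d / 2) true / (d / 2) else 0 := by
  rw [tentCount_true_eq hd, Nat.add_div_of_dvd_right (dvd_tentCount hd false)]
  congr 1
  split_ifs with h
  · obtain ⟨e, rfl⟩ := h
    rw [Nat.mul_div_cancel_left _ two_pos, Nat.mul_div_mul_left _ _ two_pos]
  · exact Nat.zero_div d

theorem tentCount_true_div_eq_unimodalC {n : ℕ} (hn : 0 < n) :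
    ((tentCount n true / n : ℕ) : ℚ) = unimodalC n := by
  rw [Nat.cast_div (dvd_tentCount hn true) (by exact_mod_cast hn.ne'), unimodalC, div_eq_mul_inv,
    one_div, mul_comm]
  congr 1
  exact_mod_cast congrArg (Int.cast : ℤ → ℚ) (tentCount_true_eq_sum hn)

open PowerSeries in
theorem one_add_two_mul_series_eq {m : ℕ} (hm : 0 < m) :
    1 + 2 * unimodalRootSeries m =
      ∏ d ∈ m.divisors, ((1 + (X : PowerSeries ℚ) ^ d) * (1 - (X : PowerSeries ℚ) ^ d)⁻¹) ^
        (tentCount d true / d) := by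
  have := finite_tentPt hm
  have := Fintype.ofFinite (PermOrbit (tentPerm hm))
  set c : ℕ → ℕ := fun d => tentCount d true / d with hc
  set u : ℕ → PowerSeries ℚ := fun d => (1 - X ^ d)⁻¹ with hu
  set v : ℕ → PowerSeries ℚ := fun d => 1 + X ^ d with hv
  have huv : ∀ d, 0 < d → v d * u (2 * d) = u d := fun d hd => by
    have h1 : (1 - (X : PowerSeries ℚ) ^ d) * u d = 1 := PowerSeries.mul_inv_cancel _ (by
      rw [constantCoeff_one_sub_X_pow hd]; exact one_ne_zero)
    have h2 : (1 - (X : PowerSeries ℚ) ^ (2 * d)) * u (2 * d) = 1 :=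
      PowerSeries.mul_inv_cancel _ (by
        rw [constantCoeff_one_sub_X_pow (by omega)]; exact one_ne_zero)
    have h3 : (1 - (X : PowerSeries ℚ) ^ (2 * d)) = (1 - X ^ d) * v d := by
      simp only [hv]; ring
    rw [h3] at h2
    linear_combination v d * u (2 * d) * (-h1) + u d * h2
  -- The odd orbits of size `d` that become even over `m` supply exactly the factors missing at `2 *
  -- d`.
  have hshift : ∏ d ∈ m.divisors, u d ^ (if 2 ∣ d then c (d / 2) else 0) =
      ∏ d ∈ m.divisors, u (2 * d) ^ (if Odd (m / d) then 0 else c d) := by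
    have h1 : ∀ d, u d ^ (if 2 ∣ d then c (d / 2) else 0) =
        if 2 ∣ d then u d ^ c (d / 2) else 1 := fun d => by split_ifs <;> simp
    have h2 : ∀ d, u (2 * d) ^ (if Odd (m / d) then 0 else c d) =
        if ¬ Odd (m / d) then u (2 * d) ^ c d else 1 := fun d => by split_ifs <;> simp_all
    simp only [h1, h2]
    rw [← Finset.prod_filter, ← Finset.prod_filter, filter_two_dvd_divisors,
      Finset.prod_image fun a _ b _ h => Nat.eq_of_mul_eq_mul_left two_pos h]
    simp
  rw [one_add_two_mul_series_eq_prod_orbits hm, prod_orbits hm]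
  -- When `m / d` is even, all `c d` odd orbits contribute `u d`, rewritten as `v d * u (2 * d)`; so
  -- `v d` has total exponent `c d` in either case.
  have hL : ∀ d ∈ m.divisors, orbitFactor d true ^ (tentPtCount m d true / d) *
      orbitFactor d false ^ (tentPtCount m d false / d) =
      v d ^ (if Odd (m / d) then c d else 0) * u d ^ (tentCount d false / d) *
        (v d ^ (if Odd (m / d) then 0 else c d) *
          u (2 * d) ^ (if Odd (m / d) then 0 else c d)) := fun d hd => by
    have hdm := Nat.dvd_of_mem_divisors hd
    have hd0 := Nat.pos_of_mem_divisors hd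
    rw [← mul_pow, huv d hd0]
    simp only [orbitFactor, if_true, Bool.false_eq_true, if_false]
    split_ifs with h
    · rw [tentPtCount_of_odd hm hdm h, tentPtCount_of_odd hm hdm h, pow_zero, mul_one]
    · rw [tentPtCount_true_of_even hm hdm h, tentPtCount_false_of_even hm hdm h, Nat.zero_div,
        Nat.add_div_of_dvd_right (dvd_tentCount hd0 false), pow_add, pow_zero, one_mul, one_mul]
  have hR : ∀ d ∈ m.divisors, (v d * u d) ^ c d =
      v d ^ (if Odd (m / d) then c d else 0) * u d ^ (tentCount d false / d) *
        v d ^ (if Odd (m / d) then 0 else c d) * u d ^ (if 2 ∣ d then c (d / 2) else 0) :=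
      fun d hd => by
    have h1 : c d = (if Odd (m / d) then c d else 0) + if Odd (m / d) then 0 else c d := by
      split_ifs <;> simp
    have h2 : c d = tentCount d false / d + if 2 ∣ d then c (d / 2) else 0 :=
      tentCount_true_div (Nat.pos_of_mem_divisors hd)
    have h3 : v d ^ c d = v d ^ (if Odd (m / d) then c d else 0) *
        v d ^ (if Odd (m / d) then 0 else c d) := by rw [← pow_add, ← h1]
    have h4 : u d ^ c d = u d ^ (tentCount d false / d) *
        u d ^ (if 2 ∣ d then c (d / 2) else 0) := by rw [← pow_add, ← h2]
    rw [mul_pow, h3, h4]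
    ring
  rw [Finset.prod_congr rfl hL, Finset.prod_congr rfl hR]
  simp only [Finset.prod_mul_distrib, hshift, mul_assoc]

open PowerSeries in
theorem isRationalSeries_of_prod {F : PowerSeries ℚ} {s : Finset ℕ} {c : ℕ → ℕ}
    (hs : ∀ d ∈ s, 0 < d) (h : 1 + 2 * F = ∏ d ∈ s,
      ((1 + (X : PowerSeries ℚ) ^ d) * (1 - (X : PowerSeries ℚ) ^ d)⁻¹) ^ c d) :
    IsRationalSeries F := by
  let A : Polynomial ℚ := ∏ d ∈ s, (1 + Polynomial.X ^ d) ^ c d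
  let B : Polynomial ℚ := ∏ d ∈ s, (1 - Polynomial.X ^ d) ^ c d
  have hA : (A : PowerSeries ℚ) = ∏ d ∈ s, (1 + X ^ d) ^ c d := by
    rw [← Polynomial.coeToPowerSeries.ringHom_apply, map_prod]
    simp
  have hB : (B : PowerSeries ℚ) = ∏ d ∈ s, (1 - X ^ d) ^ c d := by
    rw [← Polynomial.coeToPowerSeries.ringHom_apply, map_prod]
    simp
  have hBF : (B : PowerSeries ℚ) * (1 + 2 * F) = A := by
    rw [h, hA, hB, ← Finset.prod_mul_distrib]
    refine Finset.prod_congr rfl fun d hd => ?_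
    rw [← mul_pow, mul_left_comm, PowerSeries.mul_inv_cancel _ (by
      rw [constantCoeff_one_sub_X_pow (hs d hd)]; exact one_ne_zero), mul_one]
  -- Solving `1 + 2 * F = A / B` gives `F = (A - B) / (2 * B)`.
  refine ⟨A - B, 2 * B, mul_ne_zero two_ne_zero (Finset.prod_ne_zero_iff.2 fun d hd =>
    pow_ne_zero _ fun h0 => ?_), ?_⟩
  · have := congrArg (Polynomial.eval 0) h0
    simp [(hs d hd).ne'] at this
  · have h2 : ((2 : Polynomial ℚ) : PowerSeries ℚ) = 2 :=
      map_ofNat (Polynomial.coeToPowerSeries.ringHom (R := ℚ)) 2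
    rw [Polynomial.coe_mul, Polynomial.coe_sub, h2]
    linear_combination hBF

theorem corollary3 :
    ∃ c : ℕ → ℕ, (∀ n : ℕ, 1 ≤ n → (c n : ℚ) = unimodalC n) ∧
      ∀ m : ℕ, 1 ≤ m →
        IsRationalSeries (unimodalRootSeries m) ∧
        1 + 2 * unimodalRootSeries m =
          ∏ d ∈ m.divisors,
            ((1 + (PowerSeries.X : PowerSeries ℚ) ^ d) *
              (1 - (PowerSeries.X : PowerSeries ℚ) ^ d)⁻¹) ^ c d := by
  refine ⟨fun d => tentCount d true / d, fun n hn => tentCount_true_div_eq_unimodalC hn,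
    fun m hm => ?_⟩
  have h := one_add_two_mul_series_eq hm
  exact ⟨isRationalSeries_of_prod (fun d hd => Nat.pos_of_mem_divisors hd) h, h⟩
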